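/- Let $(X_i,\delta_i)_{i\in I}$ be a family of separated (Efremovič) proximity spaces, indexed by a set $I$, such that $X_i$ is non-empty for infinitely many $i\in I$. Let $(\coprod_i X_i,\delta)$ be their coproduct: the disjoint union of the sets $X_i$, with $A\,\delta\,B$ if and only if $(A\cap X_i)\,\delta_i\,(B\cap X_i)$ for some $i\in I$. Let $(\overline{\coprod_i X_i},\delta^*)$ be its Smirnov compactification: the set of all clusters of $(\coprod_i X_i,\delta)$, where $\mathcal A\,\delta^*\,\mathcal B$ if and only if $A\,\delta\,B$ for all $A,B\subseteq\coprod_i X_i$ such that $A$ belongs to every cluster in $\mathcal A$ and $B$ belongs to every cluster in $\mathcal B$. It carries the topology induced by $\delta^*$, in which $\mathcal A$ is closed if and only if it contains every cluster $\sigma$ with $\mathcal A\,\delta^*\,\{\sigma\}$, and $\coprod_i X_i$ is regarded as a subset of it by identifying each point $x$ with its point cluster $\{A : A\,\delta\,\{x\}\}$. (A cluster of $(X,\delta)$ is a non-empty collection $\sigma$ of subsets of $X$ such that: $A\,\delta\,B$ for all $A,B\in\sigma$; every $C\subseteq X$ with $C\,\delta\,A$ for all $A\in\sigma$ belongs to $\sigma$;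 and $A\cup B\in\sigma$ implies $A\in\sigma$ or $B\in\sigma$.) Then: 1. the remainder $\overline{\coprod_i X_i}\setminus\coprod_i X_i$ contains a copy of $\beta\omega\setminus\omega$, that is, a subspace homeomorphic to $\beta\omega\setminus\omega$, where $\omega$ is the countably infinite discrete space and $\beta\omega$ its Stone–Čech compactification; 2. the topology of $\overline{\coprod_i X_i}$ is not metrizable; 3. for no metric $d$ on the set $\overline{\coprod_i X_i}$ is $\delta^*$ the metric proximity of $d$, i.e. the relation "$\mathcal A$ is close to $\mathcal B$ if and only if $\inf\{d(a,b): a\in\mathcal A,\ b\in\mathcal B\}=0$" (with $\inf\emptyset=\infty$). -/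

import Mathlib

universe u v

/-- A proximity on a set `X`: a binary relation on the subsets of `X` with the five
Efremovich axioms. -/
@[ext]
structure Proximity (X : Type u) where
  /-- `Close A B` means that `A` is close to `B`. -/
  Close : Set X → Set X → Prop
  symm : ∀ A B, Close A B → Close B A
  nonempty : ∀ A B, Close A B → A.Nonempty ∧ B.Nonempty
  of_inter : ∀ A B, (A ∩ B).Nonempty → Close A B
  union_iff : ∀ A B C, Close A (B ∪ C) ↔ Close A B ∨ Close A C
  separation : ∀ A B, ¬ Close A B → ∃ E : Set X, ¬ Close A E ∧ ¬ Close Eᶜ B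

namespace Proximity

variable {X : Type u}

/-- A proximity is separated if `{x}` is close to `{y}` exactly when `x = y`. -/
def IsSeparated (δ : Proximity X) : Prop :=
  ∀ x y : X, δ.Close {x} {y} ↔ x = y

theorem mono_right (δ : Proximity X) {A B C : Set X} (h : δ.Close A B) (hBC : B ⊆ C) :
    δ.Close A C := by
  have h' := (δ.union_iff A B C).2 (Or.inl h)
  rwa [Set.union_eq_self_of_subset_left hBC] at h'

theorem mono (δ : Proximity X) {A A' B B' : Set X} (h : δ.Close A B) (hA : A ⊆ A')
    (hB : B ⊆ B') : δ.Close A' B' :=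
  δ.symm _ _ (δ.mono_right (δ.symm _ _ (δ.mono_right h hB)) hA)

/-- The topology induced by a proximity: `A` is closed iff it contains every point that is
close to it. -/
@[reducible]
def topology (δ : Proximity X) : TopologicalSpace X :=
  TopologicalSpace.ofClosed {A : Set X | ∀ x, δ.Close A {x} → x ∈ A}
    (fun x h => absurd (δ.nonempty _ _ h).1 Set.not_nonempty_empty)
    (fun S hS x h => Set.mem_sInter.2 fun A hA =>
      hS hA x (δ.mono h (Set.sInter_subset_of_mem hA) subset_rfl))
    (fun A hA B hB x h => by
      rcases (δ.union_iff _ _ _).1 (δ.symm _ _ h) with h | h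
      · exact Or.inl (hA x (δ.symm _ _ h))
      · exact Or.inr (hB x (δ.symm _ _ h)))

/-- The metric proximity of a metric `d`: `A` is close to `B` iff the infimum of the distances
`d a b` (`a ∈ A`, `b ∈ B`) is zero. The infimum is taken in `[0, ∞]`, so that it is `∞` if one
of the two sets is empty. -/
def ofMetric (d : MetricSpace X) : Proximity X where
  Close A B := (⨅ a ∈ A, ⨅ b ∈ B, edist a b) = 0
  symm A B h := by
    rw [← h, iInf₂_comm]
    simp only [edist_comm]
  nonempty A B h := by
    constructor
    · by_contra hA
      simp [Set.not_nonempty_iff_eq_empty.1 hA] at h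
    · by_contra hB
      simp [Set.not_nonempty_iff_eq_empty.1 hB] at h
  of_inter A B := by
    rintro ⟨x, hA, hB⟩
    refine le_antisymm ?_ bot_le
    exact (iInf₂_le x hA).trans ((iInf₂_le x hB).trans (edist_self x).le)
  union_iff A B C := by
    simp only [iInf_union, iInf_inf_eq]
    exact min_eq_bot
  separation A B h := by
    obtain ⟨r, hr0, hr⟩ := ENNReal.lt_iff_exists_nnreal_btwn.1 (pos_iff_ne_zero.2 h)
    have hr0' : (0 : ENNReal) < r / 2 := ENNReal.half_pos hr0.ne'
    refine ⟨{x | ∀ a ∈ A, (r / 2 : ENNReal) ≤ edist a x}, ?_, ?_⟩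
    · refine (hr0'.trans_le ?_).ne'
      exact le_iInf₂ fun a ha => le_iInf₂ fun x hx => hx a ha
    · refine (hr0'.trans_le ?_).ne'
      refine le_iInf₂ fun x hx => le_iInf₂ fun b hb => ?_
      simp only [Set.mem_compl_iff, Set.mem_ofPred_eq, not_forall, not_le] at hx
      obtain ⟨a, ha, hax⟩ := hx
      by_contra hlt
      have h1 : (r : ENNReal) < edist a b := hr.trans_le ((iInf₂_le a ha).trans (iInf₂_le b hb))
      have h2 : edist a b < r / 2 + r / 2 :=
        (edist_triangle a x b).trans_lt (ENNReal.add_lt_add hax (not_le.1 hlt))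
      rw [ENNReal.add_halves] at h2
      exact lt_asymm h1 h2

/-- The coproduct of a family of proximity spaces: the disjoint union, where `A` is close to `B`
iff for some index `i` the part of `A` in `X i` is close to the part of `B` in `X i`. -/
def coproduct {ι : Type u} {X : ι → Type v} (δ : ∀ i, Proximity (X i)) :
    Proximity (Σ i, X i) where
  Close A B := ∃ i, (δ i).Close (Sigma.mk i ⁻¹' A) (Sigma.mk i ⁻¹' B)
  symm := fun A B ⟨i, h⟩ => ⟨i, (δ i).symm _ _ h⟩
  nonempty := fun A B ⟨i, h⟩ =>
    ⟨((δ i).nonempty _ _ h).1.imp' _ fun _ hx => hx, ((δ i).nonempty _ _ h).2.imp' _ fun _ hx => hx⟩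
  of_inter := by
    rintro A B ⟨⟨i, x⟩, hA, hB⟩
    exact ⟨i, (δ i).of_inter _ _ ⟨x, hA, hB⟩⟩
  union_iff A B C := by
    simp only [Set.preimage_union, (δ _).union_iff, exists_or]
  separation A B h := by
    rw [not_exists] at h
    choose E hE using fun i => (δ i).separation _ _ (h i)
    refine ⟨{p | p.2 ∈ E p.1}, ?_, ?_⟩
    · rintro ⟨i, hi⟩
      exact (hE i).1 hi
    · rintro ⟨i, hi⟩
      exact (hE i).2 hi

/-- A cluster in a proximity space. -/
@[ext]
structure Cluster (δ : Proximity X) where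
  /-- The sets that belong to the cluster. -/
  sets : Set (Set X)
  sets_nonempty : sets.Nonempty
  close : ∀ A B, A ∈ sets → B ∈ sets → δ.Close A B
  mem_of_close : ∀ C, (∀ A ∈ sets, δ.Close C A) → C ∈ sets
  mem_or_mem : ∀ A B, A ∪ B ∈ sets → A ∈ sets ∨ B ∈ sets

namespace Cluster

variable {δ : Proximity X}

theorem univ_mem (σ : Cluster δ) : Set.univ ∈ σ.sets :=
  σ.mem_of_close _ fun A hA => δ.mono (σ.close A A hA hA) (Set.subset_univ A) subset_rfl

theorem compl_mem (σ : Cluster δ) {A : Set X} (h : A ∉ σ.sets) : Aᶜ ∈ σ.sets := by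
  have h' := σ.univ_mem
  rw [← Set.union_compl_self A] at h'
  exact (σ.mem_or_mem _ _ h').resolve_left h

end Cluster

/-- The point cluster of `x`: all sets close to `{x}`. It is the cluster containing `{x}`. -/
def pointCluster (δ : Proximity X) (x : X) : Cluster δ where
  sets := {A | δ.Close A {x}}
  sets_nonempty := ⟨{x}, δ.of_inter _ _ ⟨x, rfl, rfl⟩⟩
  close A B hA hB := by
    by_contra h
    obtain ⟨E, h1, h2⟩ := δ.separation _ _ h
    by_cases hx : x ∈ E
    · exact h1 (δ.mono_right hA (Set.singleton_subset_iff.2 hx))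
    · exact h2 (δ.symm _ _ (δ.mono_right hB (Set.singleton_subset_iff.2 hx)))
  mem_of_close C hC := hC _ (δ.of_inter _ _ ⟨x, rfl, rfl⟩)
  mem_or_mem A B h := by
    rcases (δ.union_iff _ _ _).1 (δ.symm _ _ h) with h | h
    · exact Or.inl (δ.symm _ _ h)
    · exact Or.inr (δ.symm _ _ h)

/-- `C` absorbs a set `𝒜` of clusters if it belongs to every cluster in `𝒜`. -/
def Absorbs {δ : Proximity X} (C : Set X) (𝒜 : Set (Cluster δ)) : Prop :=
  ∀ σ ∈ 𝒜, C ∈ σ.sets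

/-- The Smirnov proximity on the set of all clusters of `δ`: `𝒜` is close to `ℬ` iff every set
absorbing `𝒜` is close to every set absorbing `ℬ`. -/
def smirnov (δ : Proximity X) : Proximity (Cluster δ) where
  Close 𝒜 ℬ := ∀ A B : Set X, Absorbs A 𝒜 → Absorbs B ℬ → δ.Close A B
  symm 𝒜 ℬ h A B hA hB := δ.symm _ _ (h B A hB hA)
  nonempty 𝒜 ℬ h := by
    constructor
    · by_contra h𝒜
      rw [Set.not_nonempty_iff_eq_empty] at h𝒜
      subst h𝒜
      exact Set.not_nonempty_empty (δ.nonempty _ _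
        (h ∅ Set.univ (fun σ hσ => hσ.elim) fun σ _ => σ.univ_mem)).1
    · by_contra hℬ
      rw [Set.not_nonempty_iff_eq_empty] at hℬ
      subst hℬ
      exact Set.not_nonempty_empty (δ.nonempty _ _
        (h Set.univ ∅ (fun σ _ => σ.univ_mem) fun σ hσ => hσ.elim)).2
  of_inter := by
    rintro 𝒜 ℬ ⟨σ, h𝒜, hℬ⟩ A B hA hB
    exact σ.close _ _ (hA σ h𝒜) (hB σ hℬ)
  union_iff 𝒜 ℬ 𝒞 := by
    constructor
    · intro h
      by_contra hn
      simp only [not_or, not_forall] at hn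
      obtain ⟨⟨A₁, B, hA₁, hB, h₁⟩, ⟨A₂, C, hA₂, hC, h₂⟩⟩ := hn
      obtain ⟨E₁, hE₁, hE₁'⟩ := δ.separation _ _ h₁
      obtain ⟨E₂, hE₂, hE₂'⟩ := δ.separation _ _ h₂
      have key : δ.Close (E₁ ∪ E₂)ᶜ (B ∪ C) := by
        refine h _ _ (fun σ hσ => σ.compl_mem fun hE => ?_) ?_
        · rcases σ.mem_or_mem _ _ hE with hE | hE
          · exact hE₁ (σ.close _ _ (hA₁ σ hσ) hE)
          · exact hE₂ (σ.close _ _ (hA₂ σ hσ) hE)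
        · rintro σ (hσ | hσ)
          · exact σ.mem_of_close _ fun D hD =>
              δ.mono (σ.close _ _ (hB σ hσ) hD) Set.subset_union_left subset_rfl
          · exact σ.mem_of_close _ fun D hD =>
              δ.mono (σ.close _ _ (hC σ hσ) hD) Set.subset_union_right subset_rfl
      rcases (δ.union_iff _ _ _).1 key with h | h
      · exact hE₁' (δ.mono h (Set.compl_subset_compl.2 Set.subset_union_left) subset_rfl)
      · exact hE₂' (δ.mono h (Set.compl_subset_compl.2 Set.subset_union_right) subset_rfl)
    · rintro (h | h) A B hA hB
      · exact h A B hA fun σ hσ => hB σ (Or.inl hσ)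
      · exact h A B hA fun σ hσ => hB σ (Or.inr hσ)
  separation 𝒜 ℬ h := by
    simp only [not_forall] at h
    obtain ⟨A, B, hA, hB, h⟩ := h
    obtain ⟨E, h1, h2⟩ := δ.separation _ _ h
    exact ⟨{σ | E ∈ σ.sets}, fun h => h1 (h A E hA fun σ hσ => hσ),
      fun h => h2 (h Eᶜ B (fun σ hσ => σ.compl_mem hσ) hB)⟩

/-- The underlying set of the Smirnov compactification of a proximity space: all clusters. -/
abbrev SmirnovCompactification (δ : Proximity X) : Type u := Cluster δ

/-- The topology of the Smirnov compactification is the one induced by its proximity. -/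
instance instTopologicalSpaceSmirnov (δ : Proximity X) :
    TopologicalSpace (SmirnovCompactification δ) :=
  (smirnov δ).topology

/-- The remainder (boundary) of the Smirnov compactification: the complement of the copy of `X`
given by the point clusters. -/
def remainder (δ : Proximity X) : Set (SmirnovCompactification δ) :=
  (Set.range (pointCluster δ))ᶜ

end Proximity

open Filter Topology

namespace Proximity

variable {X : Type u} {α : Type v} {δ : Proximity X}

/-! Pick one point in each of countably many distinct summands. Disjoint subsets of this sequence
are far from each other, since no summand holds two of its points. Pushing an ultrafilter on `ℕ`
forward along the sequence and taking the sets close to all its members gives a cluster that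
remembers the ultrafilter, so the space of ultrafilters embeds in the compactification
(`isEmbedding_ofUltrafilter_map`). Nonprincipal ultrafilters leave every single summand, so they
land in the remainder.

The space of ultrafilters on `ℕ` is not first countable, which rules out metrizability. A metric
proximity induces the metric topology, so it is ruled out as well. -/

theorem isClosed_topology_iff (δ : Proximity X) {A : Set X} :
    IsClosed[δ.topology] A ↔ ∀ x, δ.Close A {x} → x ∈ A := by
  rw [← @isOpen_compl_iff _ _ δ.topology]
  change Aᶜᶜ ∈ {A : Set X | ∀ x, δ.Close A {x} → x ∈ A} ↔ _
  rw [compl_compl]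
  rfl

/-- The metric proximity induces the metric topology. -/
theorem topology_ofMetric (d : MetricSpace X) :
    (ofMetric d).topology = d.toUniformSpace.toTopologicalSpace := by
  refine TopologicalSpace.ext_iff_isClosed.2 fun A => ?_
  have key : ∀ x, (ofMetric d).Close A {x} ↔ x ∈ closure A := fun x => by
    rw [Metric.mem_closure_iff_infEDist_zero, Metric.infEDist]
    simp [ofMetric, edist_comm]
  rw [isClosed_topology_iff]
  simp only [key]
  exact ⟨fun h => isClosed_of_closure_subset h, fun h x hx => h.closure_eq ▸ hx⟩

/-- The cluster of all sets close to every member of an ultrafilter. -/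
def Cluster.ofUltrafilter (δ : Proximity X) (U : Ultrafilter X) : Cluster δ where
  sets := {A | ∀ S ∈ U, δ.Close A S}
  sets_nonempty := ⟨Set.univ, fun S hS => δ.of_inter _ _ <| by
    simpa using U.nonempty_of_mem hS⟩
  close A B hA hB := by
    by_contra h
    obtain ⟨E, h1, h2⟩ := δ.separation _ _ h
    -- `A` is far from `E` and `B` from `Eᶜ`, yet `U` contains one of the two.
    rcases U.mem_or_compl_mem E with hE | hE
    · exact h1 (hA E hE)
    · exact h2 (δ.symm _ _ (hB _ hE))
  mem_of_close C hC S hS :=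
    hC S fun T hT => δ.of_inter _ _ (U.nonempty_of_mem (inter_mem hS hT))
  mem_or_mem A B h := by
    by_contra hn
    simp only [not_or, Set.mem_ofPred_eq, not_forall] at hn
    obtain ⟨⟨S, hS, hAS⟩, T, hT, hBT⟩ := hn
    rcases (δ.union_iff _ _ _).1 (δ.symm _ _ (h _ (inter_mem hS hT))) with h | h
    · exact hAS (δ.mono_right (δ.symm _ _ h) Set.inter_subset_left)
    · exact hBT (δ.mono_right (δ.symm _ _ h) Set.inter_subset_right)

theorem Cluster.mem_ofUltrafilter {U : Ultrafilter X} {A : Set X} :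
    A ∈ (ofUltrafilter δ U).sets ↔ ∀ S ∈ U, δ.Close A S := Iff.rfl

/-- `A` itself absorbs this set, so `A` is close to every member of a cluster close to it. -/
theorem isClosed_setOf_mem_sets (A : Set X) :
    IsClosed {σ : SmirnovCompactification δ | A ∈ σ.sets} :=
  (isClosed_topology_iff _).2 fun τ h => τ.mem_of_close A fun B hB =>
    h A B (fun _ hσ => hσ) fun _ hσ => hσ ▸ hB

/-- If the cluster of `U` lies outside a closed `𝒜`, some set absorbing `𝒜` is far from some `S ∈
U`. Every ultrafilter containing `S` then also has its cluster outside `𝒜`. -/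
theorem continuous_ofUltrafilter (δ : Proximity X) :
    Continuous (fun U : Ultrafilter X =>
      (Cluster.ofUltrafilter δ U : SmirnovCompactification δ)) := by
  refine continuous_iff_isClosed.2 fun 𝒜 h𝒜 =>
    isOpen_compl_iff.1 <| isOpen_iff_mem_nhds.2 fun U hU => ?_
  have h : ¬ (smirnov δ).Close 𝒜 {Cluster.ofUltrafilter δ U} :=
    fun h => hU ((isClosed_topology_iff _).1 h𝒜 _ h)
  simp only [smirnov, not_forall] at h
  obtain ⟨A, B, hA, hB, hAB⟩ := h
  have hAU : A ∉ (Cluster.ofUltrafilter δ U).sets :=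
    fun h => hAB (Cluster.close _ _ _ h (hB _ rfl))
  simp only [Cluster.mem_ofUltrafilter, not_forall] at hAU
  obtain ⟨S, hS, hAS⟩ := hAU
  exact mem_of_superset ((ultrafilter_isOpen_basic S).mem_nhds hS)
    fun V hV hV𝒜 => hAS (hA _ hV𝒜 S hV)

theorem continuous_ultrafilter_map (j : α → X) : Continuous (Ultrafilter.map j) := by
  refine ultrafilterBasis_is_basis.continuous_iff.2 ?_
  rintro _ ⟨S, rfl⟩
  exact ultrafilter_isOpen_basic (j ⁻¹' S)

/-- A family of points whose disjoint subfamilies are far from each other extends to an embedding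
of the space of ultrafilters into the Smirnov compactification. -/
theorem isEmbedding_ofUltrafilter_map {j : α → X}
    (hj : ∀ S T : Set α, δ.Close (j '' S) (j '' T) → (S ∩ T).Nonempty) :
    IsEmbedding (fun U : Ultrafilter α =>
      (Cluster.ofUltrafilter δ (U.map j) : SmirnovCompactification δ)) := by
  -- The cluster determines `U`: `j '' S` and `j '' Sᶜ` are far, so the cluster cannot contain the
  -- former when `Sᶜ ∈ U`.
  have key : ∀ (U : Ultrafilter α) (S : Set α),
      j '' S ∈ (Cluster.ofUltrafilter δ (U.map j)).sets ↔ S ∈ U := fun U S => by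
    constructor
    · intro h
      by_contra hS
      obtain ⟨n, h1, h2⟩ := hj S Sᶜ (h _ (image_mem_map (Ultrafilter.compl_mem_iff_notMem.2 hS)))
      exact h2 h1
    · intro h T hT
      exact δ.of_inter _ _ ((U.map j).nonempty_of_mem (inter_mem (image_mem_map h) hT))
  refine ⟨⟨le_antisymm
    ((continuous_ofUltrafilter δ).comp (continuous_ultrafilter_map j)).le_induced ?_⟩, ?_⟩
  · refine le_generateFrom ?_
    rintro _ ⟨S, rfl⟩
    -- Basic open sets are pulled back directly, so the target need not be known to be Hausdorff.
    refine isOpen_induced_iff.2 ⟨_, (isClosed_setOf_mem_sets (j '' Sᶜ)).isOpen_compl, ?_⟩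
    ext U
    simp only [Set.mem_preimage, Set.mem_compl_iff, Set.mem_ofPred_eq, key,
      Ultrafilter.compl_notMem_iff]
  · intro U V h
    ext S
    rw [← key U, ← key V]
    exact iff_of_eq (congrArg (fun σ : Cluster δ => j '' S ∈ σ.sets) h)

end Proximity

/-- A countably generated ultrafilter on `ℕ` is principal. -/
theorem Ultrafilter.exists_eq_pure_of_isCountablyGenerated (U : Ultrafilter ℕ)
    [IsCountablyGenerated (U : Filter ℕ)] : ∃ n, U = pure n := by
  by_contra! hU
  have hcof : (U : Filter ℕ) ≤ atTop := Nat.cofinite_eq_atTop ▸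
    U.le_cofinite_or_eq_pure.resolve_right fun ⟨n, hn⟩ => hU n hn
  obtain ⟨u, hu⟩ := exists_seq_tendsto (U : Filter ℕ)
  obtain ⟨φ, hφ, hmono⟩ := strictMono_subseq_of_tendsto_atTop (hu.mono_right hcof)
  have hlim : Tendsto (u ∘ φ) atTop U := hu.comp hφ.tendsto_atTop
  -- An injective sequence converging to `U` would eventually have only even-indexed terms, or none.
  rcases U.mem_or_compl_mem ((u ∘ φ) '' {k | Even k}) with hS | hS
  · obtain ⟨N, hN⟩ := eventually_atTop.1 (hlim hS)
    obtain ⟨k, hk, hk'⟩ := hN (2 * N + 1) (by omega)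
    rw [hmono.injective hk'] at hk
    exact Nat.not_even_bit1 N hk
  · obtain ⟨N, hN⟩ := eventually_atTop.1 (hlim hS)
    exact hN (2 * N) (by omega) ⟨2 * N, even_two_mul N, rfl⟩

theorem not_firstCountableTopology_ultrafilter_nat :
    ¬ FirstCountableTopology (Ultrafilter ℕ) := by
  intro _
  have hc : IsCountablyGenerated (hyperfilter ℕ : Filter ℕ) := by
    -- An ultrafilter is the trace on the principal ones of its neighbourhood filter, so a countable
    -- neighbourhood base would make it countably generated.
    rw [← le_antisymm (ultrafilter_comap_pure_nhds (hyperfilter ℕ))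
      (map_le_iff_le_comap.1 (Ultrafilter.tendsto_pure_self _))]
    infer_instance
  obtain ⟨n, hn⟩ := (hyperfilter ℕ).exists_eq_pure_of_isCountablyGenerated
  have h : ({n}ᶜ : Set ℕ) ∈ hyperfilter ℕ := (Set.finite_singleton n).compl_mem_hyperfilter
  rw [hn] at h
  exact h rfl

/-- The Stone-Čech compactification of a discrete space embeds into the space of ultrafilters,
extending the inclusion of the points. -/
theorem exists_isEmbedding_stoneCech_ultrafilter (α : Type u) [TopologicalSpace α]
    [DiscreteTopology α] :
    ∃ g : StoneCech α → Ultrafilter α, IsEmbedding g ∧ ∀ a, g (stoneCechUnit a) = pure a := by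
  have hc : Continuous (pure : α → Ultrafilter α) := continuous_of_discreteTopology
  have hg := continuous_stoneCechExtend hc
  refine ⟨stoneCechExtend hc, (hg.isClosedEmbedding ?_).isEmbedding,
    stoneCechExtend_stoneCechUnit hc⟩
  -- The two extensions compose to a continuous map fixing the dense set of points.
  have hinv : Ultrafilter.extend stoneCechUnit ∘ stoneCechExtend hc = id :=
    stoneCech_hom_ext ((continuous_ultrafilter_extend _).comp hg) continuous_id <| by
      ext a
      simp [stoneCechExtend_stoneCechUnit, ultrafilter_extend_pure]
  exact Function.LeftInverse.injective (congrFun hinv)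

/-! ### Sequences meeting each summand of a coproduct at most once -/

namespace Proximity

variable {ι : Type u} {X : ι → Type v} {δ : ∀ i, Proximity (X i)} {i : ℕ → ι} {x : ∀ n, X (i n)}

theorem inter_nonempty_of_coproduct_close (hi : Function.Injective i) {S T : Set ℕ}
    (h : (coproduct δ).Close ((fun n => (⟨i n, x n⟩ : Σ i, X i)) '' S)
      ((fun n => (⟨i n, x n⟩ : Σ i, X i)) '' T)) : (S ∩ T).Nonempty := by
  obtain ⟨k, h⟩ := h
  obtain ⟨⟨a, n, hn, hna⟩, b, m, hm, hmb⟩ := (δ k).nonempty _ _ h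
  have hnm : n = m := hi ((congrArg Sigma.fst hna).trans (congrArg Sigma.fst hmb).symm)
  exact ⟨n, hn, hnm ▸ hm⟩

/-- At most one term of the sequence shares a summand with a given `y`. The remaining terms form a
set that is far from `{y}` and belongs to the pushed-forward ultrafilter. -/
theorem ofUltrafilter_mem_remainder_coproduct (hi : Function.Injective i) {U : Ultrafilter ℕ}
    (hU : ∀ n, U ≠ pure n) :
    Cluster.ofUltrafilter (coproduct δ) (U.map fun n => ⟨i n, x n⟩) ∈
      remainder (coproduct δ) := by
  rintro ⟨y, hy⟩
  have hmem : {y} ∈ (pointCluster (coproduct δ) y).sets :=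
    (coproduct δ).of_inter _ _ ⟨y, rfl, rfl⟩
  rw [hy] at hmem
  have hS : {n | i n ≠ y.1} ∈ U := by
    refine U.le_cofinite_or_eq_pure.resolve_right (fun ⟨n, hn⟩ => hU n hn) ?_
    refine Set.Subsingleton.finite fun n hn m hm => hi ?_
    simp only [Set.mem_compl_iff, Set.mem_ofPred_eq, not_not] at hn hm
    exact hn.trans hm.symm
  obtain ⟨k, h⟩ := hmem _ (image_mem_map hS)
  obtain ⟨⟨a, ha⟩, b, m, hm, hmb⟩ := (δ k).nonempty _ _ h
  have hk : k = y.1 := congrArg Sigma.fst (show (⟨k, a⟩ : Σ i, X i) = y from ha)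
  exact hm ((congrArg Sigma.fst hmb).trans hk)

end Proximity

theorem mainTheorem4 {ι : Type u} {X : ι → Type v} (δ : ∀ i, Proximity (X i))
    (hsep : ∀ i, (δ i).IsSeparated) (hinf : {i : ι | Nonempty (X i)}.Infinite) :
    (∃ f : ((Set.range (stoneCechUnit : ℕ → StoneCech ℕ))ᶜ : Set (StoneCech ℕ)) →
        Proximity.remainder (Proximity.coproduct δ),
      Topology.IsEmbedding f) ∧
    ¬ TopologicalSpace.MetrizableSpace
        (Proximity.SmirnovCompactification (Proximity.coproduct δ)) ∧
    ∀ d : MetricSpace (Proximity.SmirnovCompactification (Proximity.coproduct δ)),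
      Proximity.smirnov (Proximity.coproduct δ) ≠ Proximity.ofMetric d := by
  have hex : ∃ (i : ℕ → ι) (_ : ∀ n, X (i n)), Function.Injective i :=
    ⟨fun n => hinf.natEmbedding _ n, fun n => (hinf.natEmbedding _ n).2.some,
      Subtype.val_injective.comp (hinf.natEmbedding _).injective⟩
  obtain ⟨i, x, hi⟩ := hex
  have hemb := Proximity.isEmbedding_ofUltrafilter_map
    (fun S T => Proximity.inter_nonempty_of_coproduct_close (δ := δ) (x := x) hi (S := S) (T := T))
  have hmetr : ¬ TopologicalSpace.MetrizableSpace
      (Proximity.SmirnovCompactification (Proximity.coproduct δ)) := fun _ =>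
    not_firstCountableTopology_ultrafilter_nat hemb.isInducing.firstCountableTopology
  refine ⟨?_, hmetr, fun d hd => hmetr ?_⟩
  · obtain ⟨g, hg, hgu⟩ := exists_isEmbedding_stoneCech_ultrafilter ℕ
    have hrem : ∀ p : ((Set.range (stoneCechUnit : ℕ → StoneCech ℕ))ᶜ : Set (StoneCech ℕ)),
        Proximity.Cluster.ofUltrafilter (Proximity.coproduct δ)
          ((g p).map fun n => ⟨i n, x n⟩) ∈ Proximity.remainder (Proximity.coproduct δ) :=
      fun p => Proximity.ofUltrafilter_mem_remainder_coproduct hi fun n hn =>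
        p.2 ⟨n, hg.injective ((hgu n).trans hn.symm)⟩
    exact ⟨fun p => ⟨_, hrem p⟩, ((hemb.comp hg).comp .subtypeVal).codRestrict _ hrem⟩
  · have htop : Proximity.instTopologicalSpaceSmirnov (Proximity.coproduct δ) =
        d.toUniformSpace.toTopologicalSpace := by
      rw [← Proximity.topology_ofMetric d, ← hd]
      rfl
    rw [htop]
    infer_instance
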